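/- Fix $k\in\mathbb{N}$. All random variables are discrete with finite Shannon entropy. For a distribution over a finite set $\mathbf{Y}$ of variables, let $\mathcal{G}_k(\mathbf{Y})$ be the set of DAGs on $\mathbf{Y}$ in which every variable has at most $k$ parents, let the score of $G\in\mathcal{G}_k(\mathbf{Y})$ be $\mathcal{S}(G):=-\sum_{Y\in\mathbf{Y}}H(Y\mid \Pi_Y(G))$, where $\Pi_Y(G)$ is the set of parents of $Y$ in $G$, and let $\mathcal{S}^*:=\max_{G\in\mathcal{G}_k(\mathbf{Y})}\mathcal{S}(G)$. Two DAGs are Markov equivalent if they induce the same conditional independence constraints (d-separations). An EC is a Markov equivalence class of $\mathcal{G}_k(\mathbf{Y})$; Markov equivalent DAGs have the same score, which is called the score of the EC; an EC is optimal if its score is maximal. For $\gamma>0$ and $V\subseteq\mathbf{Y}$, the distribution is called $(\gamma,V)$-stable if (1) in every $G\in\mathcal{G}_k(\mathbf{Y})$ with $\mathcal{S}(G)\ge\mathcal{S}^*-\gamma$, the parents of all the variables in $V$ are also in $V$; and (2) the marginal distribution on $V$ has a unique optimal EC, whose score exceeds the score of every other EC on $V$ by more than $\gamma$. Let $\alpha,\beta>0$,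 and let $\mathcal{D}_1$ be a distribution over a finite set of variables $\mathbf{X}_1$, with $X_a\in\mathbf{X}_1$, such that (I) $\mathcal{D}_1$ has a unique optimal EC, and its score exceeds that of every other EC by at least $\beta$; (II) $X_a$ has no children in any of the DAGs in the optimal EC; (III) $H(X_a\mid\mathbf{X}_1\setminus\{X_a\})=\alpha$. Let $\mathbf{X}:=\mathbf{X}_1\cup\{X_b\}$, where $X_b\notin\mathbf{X}_1$ is a new variable, and $d:=|\mathbf{X}|$. Let $\lambda\in\left(0,\min(\alpha,\frac{\beta}{3d})\right)$, and let $\mathcal{D}_2(\lambda)$ be a distribution of $\mathbf{X}$ whose marginal on $\mathbf{X}_1$ is $\mathcal{D}_1$, such that (IV) there is a hidden Bernoulli variable $C$ independent of $\mathbf{X}_1$ with $P[X_b=X_a\mid C=1]=1$ and with $X_b$ independent of $\mathbf{X}_1$ conditionally on $C=0$; and (V) $\max(H(X_b\mid X_a),H(X_a\mid X_b))=\lambda$. Then $\mathcal{D}_2(\lambda)$ is $(\gamma,V)$-stable for $V:=\mathbf{X}_1\setminus\{X_a\}$ and for every $\gamma$ with $0<\gamma\le\beta-3d\lambda$. -/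

import Mathlib

noncomputable section

namespace BayesNet

/-- The set `𝒢_{d,k}`: directed acyclic graphs on the node set `ι` in which every node has at most
`k` parents, given by the parent set of each node. There is an edge `u → v` iff
`u ∈ parents v`. -/
@[ext]
structure BDAG (ι : Type*) (k : ℕ) where
  parents : ι → Finset ι
  acyclic : ∀ v, ¬ Relation.TransGen (fun u w => u ∈ parents w) v v
  card_parents_le : ∀ v, (parents v).card ≤ k

namespace BDAG

variable {ι : Type*} {k : ℕ}

/-- `G.Edge u v`: there is a directed edge `u → v` in `G`. -/
def Edge (G : BDAG ι k) (u v : ι) : Prop := u ∈ G.parents v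

/-- The list `l` of nodes is a path (without repeated nodes, edges traversed in either direction)
from `x` to `y` that is active given `Z`: every collider `u → v ← w` on it has a descendant in `Z`
(`v` counts as a descendant of itself), and no other inner node of the path lies in `Z`. -/
def IsActivePath (G : BDAG ι k) (Z : Set ι) (x y : ι) (l : List ι) : Prop :=
  l.Nodup ∧ l.head? = some x ∧ l.getLast? = some y ∧
    l.IsChain (fun u v => G.Edge u v ∨ G.Edge v u) ∧
    ∀ u v w, [u, v, w] <:+: l →
      ((G.Edge u v ∧ G.Edge w v) → ∃ z ∈ Z, Relation.ReflTransGen G.Edge v z) ∧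
      (¬ (G.Edge u v ∧ G.Edge w v) → v ∉ Z)

/-- d-separation of the node sets `X` and `Y` by `Z`: the conditional independence constraint
`X ⊥ Y | Z` is induced by `G`. -/
def DSep (G : BDAG ι k) (X Y Z : Set ι) : Prop :=
  ∀ x ∈ X, ∀ y ∈ Y, ¬ ∃ l, G.IsActivePath Z x y l

/-- Markov equivalence: the two graphs induce the same conditional independence constraints. -/
def MarkovEquiv (G G' : BDAG ι k) : Prop :=
  ∀ X Y Z : Set ι, Disjoint X Y → Disjoint X Z → Disjoint Y Z →
    (G.DSep X Y Z ↔ G'.DSep X Y Z)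

/-- Markov equivalence as an equivalence relation on `𝒢_{d,k}`. -/
def markovSetoid (ι : Type*) (k : ℕ) : Setoid (BDAG ι k) where
  r := MarkovEquiv
  iseqv :=
    { refl := fun _ _ _ _ _ _ _ => Iff.rfl
      symm := fun h X Y Z h₁ h₂ h₃ => (h X Y Z h₁ h₂ h₃).symm
      trans := fun h h' X Y Z h₁ h₂ h₃ => (h X Y Z h₁ h₂ h₃).trans (h' X Y Z h₁ h₂ h₃) }

end BDAG

/-- The Markov equivalence classes (ECs) of `𝒢_{d,k}`. -/
def EC (ι : Type*) (k : ℕ) : Type _ := Quotient (BDAG.markovSetoid ι k)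

/-- The equivalence class of a graph. -/
def EC.mk {ι : Type*} {k : ℕ} (G : BDAG ι k) : EC ι k := Quotient.mk (BDAG.markovSetoid ι k) G

/-- The real-valued probability of the event `A`. -/
def prob {Ω : Type*} (p : PMF Ω) (A : Set Ω) : ℝ := (p.toOuterMeasure A).toReal

variable {ι S : Type*}

/-- The marginal on the variables in `V` of a joint distribution `p` of discrete random
variables `(X_i)_{i ∈ ι}`. -/
def marginal (p : PMF (ι → S)) (V : Finset ι) : PMF (V → S) := p.map (fun x i => x i)

/-- The variable `X_i` has finite Shannon entropy `-∑ₛ P(X_i = s) log P(X_i = s)`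
(a sum of nonnegative terms). -/
def FiniteEntropy (p : PMF (ι → S)) (i : ι) : Prop :=
  Summable fun s : S => Real.negMulLog (prob p {x | x i = s})

/-- The conditional Shannon entropy `H(X_i ∣ Π) = -𝔼[log P(X_i ∣ Π)]`, where
`P(X_i ∣ Π) = P(X_i, Π) / P(Π)`. The denominator is positive wherever `p x ≠ 0`. -/
def condEntropy (p : PMF (ι → S)) (i : ι) (Pa : Finset ι) : ℝ :=
  -∑' x : ι → S, (p x).toReal *
    Real.log (prob p {y | y i = x i ∧ ∀ j ∈ Pa, y j = x j} / prob p {y | ∀ j ∈ Pa, y j = x j})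

/-- The score `𝒮(G) = -∑ᵢ H(X_i ∣ Πᵢ(G))`. -/
def score [Fintype ι] {k : ℕ} (p : PMF (ι → S)) (G : BDAG ι k) : ℝ :=
  -∑ i, condEntropy p i (G.parents i)

/-- The optimal score `𝒮* = max_{G ∈ 𝒢_{d,k}} 𝒮(G)` (a maximum over a finite nonempty set). -/
def optScore [Fintype ι] (p : PMF (ι → S)) (k : ℕ) : ℝ :=
  ⨆ G : BDAG ι k, score p G

/-- The score of an equivalence class: the score of its graphs. Markov equivalent graphs have
identical scores, so that the (finite) supremum below is this common value. -/
def ecScore [Fintype ι] {k : ℕ} (p : PMF (ι → S)) (E : EC ι k) : ℝ :=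
  sSup (score p '' {G | EC.mk G = E})

/-- An optimal EC: one that maximizes the score over all ECs. -/
def IsOptimalEC [Fintype ι] {k : ℕ} (p : PMF (ι → S)) (E : EC ι k) : Prop :=
  ∀ E' : EC ι k, ecScore p E' ≤ ecScore p E

/-- `E` is the unique optimal EC. -/
def IsUniqueOptimalEC [Fintype ι] {k : ℕ} (p : PMF (ι → S)) (E : EC ι k) : Prop :=
  IsOptimalEC p E ∧ ∀ E' : EC ι k, IsOptimalEC p E' → E' = E

/-- `p` is `(γ, V)`-stable (for in-degree bound `k`):
* in every graph whose score is at least `𝒮* - γ`, the parents of the variables in `V` are in `V`;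
* the marginal of `p` on `V` has a unique optimal EC, and its score exceeds that of every other
  EC on `V` by more than `γ`. -/
def IsStable [Fintype ι] (p : PMF (ι → S)) (k : ℕ) (γ : ℝ) (V : Finset ι) : Prop :=
  (∀ G : BDAG ι k, optScore p k - γ ≤ score p G → ∀ v ∈ V, G.parents v ⊆ V) ∧
  ∃ E : EC V k, IsUniqueOptimalEC (marginal p V) E ∧
    ∀ E' : EC V k, E' ≠ E → γ < ecScore (marginal p V) E - ecScore (marginal p V) E'

/-- The joint distribution `D₂` of `(X_b, X₁)`, where `X_b` has index `none` and the variables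
`X₁` have the indices `some i`, extends the distribution `D₁` of `X₁` by an independently noisy
version `X_b` of `X_a`: there is a joint law `Q` of `(X_b, X₁)` and a hidden Bernoulli variable `C`
(`true` for `1`, `false` for `0`) such that `C` is independent of `X₁`, `X_b = X_a` almost surely
given `C = 1`, and `X_b` is independent of `X₁` given `C = 0`. -/
def IsNoisyCopy (D₁ : PMF (ι → S)) (a : ι) (D₂ : PMF (Option ι → S)) : Prop :=
  D₂.map (fun x i => x (some i)) = D₁ ∧
  ∃ Q : PMF ((Option ι → S) × Bool), Q.map Prod.fst = D₂ ∧
    (∀ (x : ι → S) (c : Bool),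
      prob Q {w | (∀ i, w.1 (some i) = x i) ∧ w.2 = c} =
        prob Q {w | ∀ i, w.1 (some i) = x i} * prob Q {w | w.2 = c}) ∧
    prob Q {w | w.1 none = w.1 (some a) ∧ w.2 = true} = prob Q {w | w.2 = true} ∧
    (∀ (x : ι → S) (s : S),
      prob Q {w | w.1 none = s ∧ (∀ i, w.1 (some i) = x i) ∧ w.2 = false} *
          prob Q {w | w.2 = false} =
        prob Q {w | w.1 none = s ∧ w.2 = false} *
          prob Q {w | (∀ i, w.1 (some i) = x i) ∧ w.2 = false})

end BayesNet

end

/-! Write $S_1^*$ for the optimal score on $\mathbf{X}_1$ and $n=|\mathbf{X}_1|=d-1$. Condition (1):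
if some $v\in V$ has $X_a$ or $X_b$ as a parent in $G$, merge these two nodes. By (V) this costs at
most $n\lambda$ in score (`exists_contraction_score`), and in the merged graph $X_a$ has the child
$v$, so that graph lies outside the optimal EC and scores at most $S_1^*-\beta$. Hanging $X_b$ below
$X_a$ gives $\mathcal{S}^*\ge S_1^*-\lambda$ (`score_sub_le_optScore`). Hence
$\mathcal{S}(G)\le\mathcal{S}^*-\beta+d\lambda<\mathcal{S}^*-\gamma$. Condition (2): $X_a$ is a sink
throughout the optimal EC, so its term splits off the score. Give a DAG on $V$ the sink $X_a$ with
the parents it has in a best graph $G_1$: the common term cancels, and the gap $\beta>\gamma$ on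
$\mathbf{X}_1$ passes to $V$ (`exists_ec_gap_of_sink`). This needs Markov equivalence to survive
deletion of a common sink (`MarkovEquiv.restrict`). All entropy estimates come from monotonicity and
submodularity of joint entropy. -/

noncomputable section

namespace BayesNet

open scoped ENNReal

/-! ### Joint entropy: monotonicity, submodularity, finiteness. -/

section Entropy

variable {ι κ S : Type*}

/-- The assignments that agree with `x` on `A`. -/
def cyl (A : Finset ι) (x : ι → S) : Set (ι → S) := {y | ∀ j ∈ A, y j = x j}

/-- The probability that the variables in `A` take the values that they have in `x`. -/
def cylMass (p : PMF (ι → S)) (A : Finset ι) (x : ι → S) : ℝ≥0∞ := p.toOuterMeasure (cyl A x)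

/-- The joint Shannon entropy of the variables in `A`, as an extended nonnegative real. -/
def jointEntropy (p : PMF (ι → S)) (A : Finset ι) : ℝ≥0∞ :=
  ∑' x, p x * ENNReal.ofReal (-Real.log (cylMass p A x).toReal)

theorem mem_cyl_self (A : Finset ι) (x : ι → S) : x ∈ cyl A x := fun _ _ => rfl

theorem cyl_anti {A B : Finset ι} (h : A ⊆ B) (x : ι → S) : cyl B x ⊆ cyl A x :=
  fun _ hy j hj => hy j (h hj)

theorem cyl_congr {A : Finset ι} {x y : ι → S} (h : y ∈ cyl A x) : cyl A y = cyl A x := by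
  ext z
  exact ⟨fun hz j hj => (hz j hj).trans (h j hj), fun hz j hj => (hz j hj).trans (h j hj).symm⟩

theorem cylMass_congr (p : PMF (ι → S)) {A : Finset ι} {x y : ι → S} (h : y ∈ cyl A x) :
    cylMass p A y = cylMass p A x := by
  rw [cylMass, cyl_congr h, cylMass]

theorem cylMass_le_one (p : PMF (ι → S)) (A : Finset ι) (x : ι → S) : cylMass p A x ≤ 1 := by
  rw [cylMass, PMF.toOuterMeasure_apply, ← p.tsum_coe]
  exact ENNReal.tsum_le_tsum fun y => Set.indicator_le_self _ _ y

theorem cylMass_ne_top (p : PMF (ι → S)) (A : Finset ι) (x : ι → S) : cylMass p A x ≠ ∞ :=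
  ne_top_of_le_ne_top ENNReal.one_ne_top (cylMass_le_one p A x)

theorem cylMass_anti (p : PMF (ι → S)) {A B : Finset ι} (h : A ⊆ B) (x : ι → S) :
    cylMass p B x ≤ cylMass p A x :=
  p.toOuterMeasure.mono (cyl_anti h x)

open Classical in
theorem cylMass_eq_tsum (p : PMF (ι → S)) (A : Finset ι) (x : ι → S) :
    cylMass p A x = ∑' y, if y ∈ cyl A x then p y else 0 := by
  rw [cylMass, PMF.toOuterMeasure_apply]
  rfl

theorem le_cylMass (p : PMF (ι → S)) (A : Finset ι) (x : ι → S) : p x ≤ cylMass p A x := by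
  classical
  rw [cylMass_eq_tsum]
  refine le_trans ?_ (ENNReal.le_tsum x)
  rw [if_pos (mem_cyl_self A x)]

theorem cylMass_toReal_pos (p : PMF (ι → S)) (A : Finset ι) {x : ι → S} (hx : p x ≠ 0) :
    0 < (cylMass p A x).toReal :=
  ENNReal.toReal_pos (fun h => hx (le_antisymm (h ▸ le_cylMass p A x) zero_le))
    (cylMass_ne_top p A x)

theorem cylMass_toReal_le_one (p : PMF (ι → S)) (A : Finset ι) (x : ι → S) :
    (cylMass p A x).toReal ≤ 1 := by
  simpa using ENNReal.toReal_mono ENNReal.one_ne_top (cylMass_le_one p A x)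

theorem neg_log_cylMass_nonneg (p : PMF (ι → S)) (A : Finset ι) (x : ι → S) :
    0 ≤ -Real.log (cylMass p A x).toReal :=
  neg_nonneg.2 (Real.log_nonpos ENNReal.toReal_nonneg (cylMass_toReal_le_one p A x))

theorem jointEntropy_mono (p : PMF (ι → S)) {A B : Finset ι} (h : A ⊆ B) :
    jointEntropy p A ≤ jointEntropy p B := by
  refine ENNReal.tsum_le_tsum fun x => ?_
  by_cases hx : p x = 0
  · simp [hx]
  · gcongr
    · exact cylMass_toReal_pos p B hx
    · exact cylMass_ne_top p A x
    · exact cylMass_anti p h x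

theorem toReal_jointEntropy_mono {p : PMF (ι → S)} (h : ∀ A, jointEntropy p A ≠ ∞) {A B : Finset ι} (hAB : A ⊆ B) :
    (jointEntropy p A).toReal ≤ (jointEntropy p B).toReal :=
  ENNReal.toReal_mono (h B) (jointEntropy_mono p hAB)

-- The `x` matching `y` on `A` and `z` on `B` form either no assignment at all or one cylinder over
-- `A ∪ B`, whose mass cancels the inverse. If there is any, `y` and `z` must agree on `A ∩ B`.
open Classical in
theorem tsum_agree_le [DecidableEq ι] (p : PMF (ι → S)) (A B : Finset ι) (y z : ι → S) :
    (∑' x, if y ∈ cyl A x ∧ z ∈ cyl B x then p x * (cylMass p (A ∪ B) x)⁻¹ else 0) ≤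
      if y ∈ cyl (A ∩ B) z then 1 else 0 := by
  by_cases h : ∃ ξ, y ∈ cyl A ξ ∧ z ∈ cyl B ξ
  · obtain ⟨ξ, hy, hz⟩ := h
    have hyz : y ∈ cyl (A ∩ B) z := fun j hj =>
      (hy j (Finset.mem_inter.1 hj).1).trans (hz j (Finset.mem_inter.1 hj).2).symm
    have key : ∀ x, (if y ∈ cyl A x ∧ z ∈ cyl B x then p x * (cylMass p (A ∪ B) x)⁻¹ else 0) =
        (if x ∈ cyl (A ∪ B) ξ then p x else 0) * (cylMass p (A ∪ B) ξ)⁻¹ := by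
      intro x
      have hiff : (y ∈ cyl A x ∧ z ∈ cyl B x) ↔ x ∈ cyl (A ∪ B) ξ := by
        constructor
        · rintro ⟨h1, h2⟩ j hj
          rcases Finset.mem_union.1 hj with hj | hj
          · exact (h1 j hj).symm.trans (hy j hj)
          · exact (h2 j hj).symm.trans (hz j hj)
        · intro hx
          exact ⟨fun j hj => (hy j hj).trans (hx j (Finset.mem_union_left _ hj)).symm,
            fun j hj => (hz j hj).trans (hx j (Finset.mem_union_right _ hj)).symm⟩
      by_cases hx : x ∈ cyl (A ∪ B) ξ
      · rw [if_pos (hiff.2 hx), if_pos hx, cylMass_congr p hx]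
      · rw [if_neg (fun h => hx (hiff.1 h)), if_neg hx, zero_mul]
    rw [tsum_congr key, ENNReal.tsum_mul_right, ← cylMass_eq_tsum, if_pos hyz]
    exact ENNReal.mul_inv_le_one _
  · have : ∀ x, ¬ (y ∈ cyl A x ∧ z ∈ cyl B x) := fun x hx => h ⟨x, hx⟩
    simp [this]

/-- The ratio inside the logarithm of the submodularity inequality has mean at most one. Expand the
masses of `A` and `B` as sums over `y` and `z`, then sum over `x` before `y` and `z`. -/
theorem tsum_ratio_le_one [DecidableEq ι] (p : PMF (ι → S)) (A B : Finset ι) :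
    ∑' x, p x * (cylMass p A x * cylMass p B x *
      ((cylMass p (A ∪ B) x)⁻¹ * (cylMass p (A ∩ B) x)⁻¹)) ≤ 1 := by
  classical
  have step : ∀ x, p x * (cylMass p A x * cylMass p B x *
      ((cylMass p (A ∪ B) x)⁻¹ * (cylMass p (A ∩ B) x)⁻¹)) =
      ∑' y, ∑' z, (if y ∈ cyl A x ∧ z ∈ cyl B x then p x * (cylMass p (A ∪ B) x)⁻¹ else 0) *
        (p y * (p z * (cylMass p (A ∩ B) z)⁻¹)) := by
    intro x
    have hz : ∀ y, ∑' z, (if y ∈ cyl A x ∧ z ∈ cyl B x then p x * (cylMass p (A ∪ B) x)⁻¹ else 0) *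
        (p y * (p z * (cylMass p (A ∩ B) z)⁻¹)) =
        (if y ∈ cyl A x then p y else 0) *
          (p x * (cylMass p (A ∪ B) x)⁻¹ * (cylMass p (A ∩ B) x)⁻¹ * cylMass p B x) := by
      intro y
      rw [cylMass_eq_tsum p B x, ← ENNReal.tsum_mul_left, ← ENNReal.tsum_mul_left]
      refine tsum_congr fun z => ?_
      by_cases h1 : y ∈ cyl A x <;> by_cases h2 : z ∈ cyl B x
      · have : cylMass p (A ∩ B) z = cylMass p (A ∩ B) x :=
          cylMass_congr p (cyl_anti Finset.inter_subset_right x h2)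
        rw [if_pos ⟨h1, h2⟩, if_pos h1, if_pos h2, this]
        ring
      all_goals simp [h1, h2]
    rw [tsum_congr hz, ENNReal.tsum_mul_right, ← cylMass_eq_tsum]
    ring
  rw [tsum_congr step, ENNReal.tsum_comm]
  calc _ = ∑' y, ∑' z, (∑' x, if y ∈ cyl A x ∧ z ∈ cyl B x then
          p x * (cylMass p (A ∪ B) x)⁻¹ else 0) * (p y * (p z * (cylMass p (A ∩ B) z)⁻¹)) := by
        refine tsum_congr fun y => ?_
        rw [ENNReal.tsum_comm]
        exact tsum_congr fun z => ENNReal.tsum_mul_right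
    _ ≤ ∑' y, ∑' z, (if y ∈ cyl (A ∩ B) z then 1 else 0) *
          (p y * (p z * (cylMass p (A ∩ B) z)⁻¹)) := by
        refine ENNReal.tsum_le_tsum fun y => ENNReal.tsum_le_tsum fun z => ?_
        gcongr
        exact tsum_agree_le p A B y z
    _ = ∑' z, ∑' y, (if y ∈ cyl (A ∩ B) z then p y else 0) *
          (p z * (cylMass p (A ∩ B) z)⁻¹) := by
        rw [ENNReal.tsum_comm]
        refine tsum_congr fun z => tsum_congr fun y => ?_
        split_ifs <;> simp
    _ = ∑' z, p z * (cylMass p (A ∩ B) z * (cylMass p (A ∩ B) z)⁻¹) := by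
        refine tsum_congr fun z => ?_
        rw [ENNReal.tsum_mul_right, ← cylMass_eq_tsum]
        ring
    _ ≤ ∑' z, p z * 1 := by
        gcongr
        exact ENNReal.mul_inv_le_one _
    _ = 1 := by simp [p.tsum_coe]

/-- Submodularity of the joint entropy. -/
theorem jointEntropy_union_add_inter_le [DecidableEq ι] (p : PMF (ι → S)) (A B : Finset ι) :
    jointEntropy p (A ∪ B) + jointEntropy p (A ∩ B) ≤ jointEntropy p A + jointEntropy p B := by
  -- The pointwise bound `log t ≤ t - 1` for that ratio, arranged without subtraction since the
  -- entropies may still be infinite.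
  have hpt : ∀ x, p x * ENNReal.ofReal (-Real.log (cylMass p (A ∪ B) x).toReal) +
      p x * ENNReal.ofReal (-Real.log (cylMass p (A ∩ B) x).toReal) + p x ≤
      p x * ENNReal.ofReal (-Real.log (cylMass p A x).toReal) +
      p x * ENNReal.ofReal (-Real.log (cylMass p B x).toReal) +
      p x * (cylMass p A x * cylMass p B x *
        ((cylMass p (A ∪ B) x)⁻¹ * (cylMass p (A ∩ B) x)⁻¹)) := by
    intro x
    by_cases hx : p x = 0
    · simp [hx]
    have pos := fun C : Finset ι => cylMass_toReal_pos p C hx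
    have hof : ∀ C, cylMass p C x = ENNReal.ofReal (cylMass p C x).toReal :=
      fun C => (ENNReal.ofReal_toReal (cylMass_ne_top p C x)).symm
    have hr : cylMass p A x * cylMass p B x *
        ((cylMass p (A ∪ B) x)⁻¹ * (cylMass p (A ∩ B) x)⁻¹) =
        ENNReal.ofReal ((cylMass p A x).toReal * (cylMass p B x).toReal *
          ((cylMass p (A ∪ B) x).toReal⁻¹ * (cylMass p (A ∩ B) x).toReal⁻¹)) := by
      rw [ENNReal.ofReal_mul (by positivity), ENNReal.ofReal_mul (by positivity),
        ENNReal.ofReal_mul (by positivity), ENNReal.ofReal_inv_of_pos (pos _),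
        ENNReal.ofReal_inv_of_pos (pos _), ← hof, ← hof, ← hof, ← hof]
    rw [hr]
    nth_rewrite 3 [← mul_one (p x)]
    rw [← mul_add, ← mul_add, ← mul_add, ← mul_add]
    refine mul_le_mul' le_rfl ?_
    have n := fun C => neg_log_cylMass_nonneg p C x
    have ha := pos A
    have hb := pos B
    have hu := pos (A ∪ B)
    have hm := pos (A ∩ B)
    rw [← ENNReal.ofReal_one, ← ENNReal.ofReal_add (n _) (n _), ← ENNReal.ofReal_add (n _) (n _),
      ← ENNReal.ofReal_add (add_nonneg (n _) (n _)) zero_le_one,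
      ← ENNReal.ofReal_add (add_nonneg (n _) (n _)) (by positivity)]
    apply ENNReal.ofReal_le_ofReal
    have hlog := Real.log_le_sub_one_of_pos (x := (cylMass p A x).toReal * (cylMass p B x).toReal *
          ((cylMass p (A ∪ B) x).toReal⁻¹ * (cylMass p (A ∩ B) x).toReal⁻¹)) (by positivity)
    rw [Real.log_mul (by positivity) (by positivity), Real.log_mul ha.ne' hb.ne',
      Real.log_mul (by positivity) (by positivity), Real.log_inv, Real.log_inv] at hlog
    linarith
  have hsum := ENNReal.tsum_le_tsum hpt
  rw [ENNReal.tsum_add, ENNReal.tsum_add, ENNReal.tsum_add, ENNReal.tsum_add, p.tsum_coe] at hsum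
  exact (ENNReal.add_le_add_iff_right ENNReal.one_ne_top).1
    (hsum.trans (add_le_add_right (tsum_ratio_le_one p A B) _))

@[simp]
theorem jointEntropy_empty (p : PMF (ι → S)) : jointEntropy p ∅ = 0 := by
  have : ∀ x, cylMass p ∅ x = 1 := by
    intro x
    classical
    simp [cylMass_eq_tsum, cyl, p.tsum_coe]
  simp [jointEntropy, this]

theorem tsum_mul_comp {Ω Ω' : Type*} (p : PMF Ω) (f : Ω → Ω') (F : Ω' → ℝ≥0∞) :
    ∑' y, (p.map f) y * F y = ∑' x, p x * F (f x) := by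
  classical
  simp_rw [PMF.map_apply, ← ENNReal.tsum_mul_right]
  rw [ENNReal.tsum_comm]
  refine tsum_congr fun x => ?_
  rw [tsum_eq_single (f x) (fun y hy => by simp [hy])]
  simp

theorem jointEntropy_singleton_ne_top {p : PMF (ι → S)} {i : ι} (h : FiniteEntropy p i) :
    jointEntropy p {i} ≠ ∞ := by
  have hprob : ∀ s, prob p {x | x i = s} = ((p.map (fun x => x i)) s).toReal := by
    intro s
    rw [prob, ← PMF.toOuterMeasure_apply_singleton, PMF.toOuterMeasure_map_apply]
    rfl
  have hmass : ∀ x, (cylMass p {i} x).toReal = ((p.map (fun x => x i)) (x i)).toReal := by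
    intro x
    rw [← hprob, prob, cylMass]
    simp [cyl]
  have hle : ∀ s, ((p.map (fun x => x i)) s).toReal ≤ 1 := fun s => by
    simpa using ENNReal.toReal_mono ENNReal.one_ne_top (PMF.coe_le_one (p.map (fun x => x i)) s)
  have : jointEntropy p {i} = ∑' s, ENNReal.ofReal (Real.negMulLog (prob p {x | x i = s})) := by
    simp_rw [jointEntropy, hmass, hprob]
    rw [← tsum_mul_comp p (fun x => x i)
      (fun s => ENNReal.ofReal (-Real.log ((p.map (fun x => x i)) s).toReal))]
    refine tsum_congr fun s => ?_
    rw [Real.negMulLog, neg_mul, ← mul_neg, ENNReal.ofReal_mul ENNReal.toReal_nonneg,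
      ENNReal.ofReal_toReal (PMF.apply_ne_top _ _)]
  rw [this]
  refine Summable.tsum_ofReal_ne_top h

theorem jointEntropy_ne_top {p : PMF (ι → S)} (h : ∀ i, FiniteEntropy p i) (A : Finset ι) :
    jointEntropy p A ≠ ∞ := by
  classical
  induction A using Finset.induction_on with
  | empty => simp
  | insert i A _ ih =>
    have := jointEntropy_union_add_inter_le p {i} A
    rw [← Finset.insert_eq] at this
    exact ne_top_of_le_ne_top (ENNReal.add_ne_top.2 ⟨jointEntropy_singleton_ne_top (h i), ih⟩)
      (le_self_add.trans this)

theorem jointEntropy_map (p : PMF (ι → S)) (e : κ ↪ ι) (A : Finset κ) :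
    jointEntropy (p.map fun x j => x (e j)) A = jointEntropy p (A.map e) := by
  rw [jointEntropy, tsum_mul_comp p (fun x j => x (e j)), jointEntropy]
  refine tsum_congr fun x => ?_
  have : cylMass (p.map fun x j => x (e j)) A (fun j => x (e j)) = cylMass p (A.map e) x := by
    rw [cylMass, PMF.toOuterMeasure_map_apply, cylMass]
    congr 1
    ext y
    simp [cyl]
  rw [this]

theorem hasSum_jointEntropy {p : PMF (ι → S)} {A : Finset ι} (h : jointEntropy p A ≠ ∞) :
    HasSum (fun x => (p x).toReal * -Real.log (cylMass p A x).toReal) (jointEntropy p A).toReal := by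
  have := ENNReal.hasSum_toReal h
  rw [← ENNReal.tsum_toReal_eq (ENNReal.ne_top_of_tsum_ne_top h)] at this
  simpa only [ENNReal.toReal_mul, ENNReal.toReal_ofReal (neg_log_cylMass_nonneg p A _),
    jointEntropy] using this

theorem condEntropy_eq [DecidableEq ι] {p : PMF (ι → S)} (h : ∀ A, jointEntropy p A ≠ ∞) (i : ι)
    (Pa : Finset ι) :
    condEntropy p i Pa = (jointEntropy p (insert i Pa)).toReal - (jointEntropy p Pa).toReal := by
  have hs := (hasSum_jointEntropy (h (insert i Pa))).sub (hasSum_jointEntropy (h Pa))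
  rw [← hs.tsum_eq, condEntropy, ← tsum_neg]
  refine tsum_congr fun x => ?_
  have h1 : prob p {y | y i = x i ∧ ∀ j ∈ Pa, y j = x j} = (cylMass p (insert i Pa) x).toReal := by
    rw [prob, cylMass]
    simp [cyl]
  have h2 : prob p {y | ∀ j ∈ Pa, y j = x j} = (cylMass p Pa x).toReal := rfl
  by_cases hx : p x = 0
  · simp [hx]
  · rw [h1, h2, Real.log_div (cylMass_toReal_pos p _ hx).ne' (cylMass_toReal_pos p _ hx).ne']
    ring

end Entropy

/-! ### Inequalities for conditional entropy. -/

section CondEntropy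

variable {ι κ S : Type*} [DecidableEq ι] {p : PMF (ι → S)}

theorem condEntropy_nonneg (h : ∀ A, jointEntropy p A ≠ ∞) (i : ι) (Pa : Finset ι) :
    0 ≤ condEntropy p i Pa := by
  rw [condEntropy_eq h]
  exact sub_nonneg.2 (toReal_jointEntropy_mono h (Finset.subset_insert _ _))

theorem condEntropy_anti (h : ∀ A, jointEntropy p A ≠ ∞) (i : ι) {Pa Pb : Finset ι}
    (hab : Pa ⊆ Pb) : condEntropy p i Pb ≤ condEntropy p i Pa := by
  by_cases hi : i ∈ Pb
  · refine le_trans (le_of_eq ?_) (condEntropy_nonneg h i Pa)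
    rw [condEntropy_eq h, Finset.insert_eq_self.2 hi, sub_self]
  -- As `i ∉ Pb`, the union is `insert i Pb` and the intersection is `Pa`.
  · have hsub := jointEntropy_union_add_inter_le p (insert i Pa) Pb
    rw [Finset.insert_union, Finset.union_eq_right.2 hab, Finset.insert_inter_of_notMem hi,
      Finset.inter_eq_left.2 hab] at hsub
    have := ENNReal.toReal_mono (ENNReal.add_ne_top.2 ⟨h _, h _⟩) hsub
    rw [ENNReal.toReal_add (h _) (h _), ENNReal.toReal_add (h _) (h _)] at this
    rw [condEntropy_eq h, condEntropy_eq h]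
    linarith

/-- With $R=\{a\}\cup(\Pi\setminus\{b\})$: $H(v\mid R)\le H(v,b\mid R)=H(b\mid R)+H(v\mid b,R)$, and
dropping conditions only increases both terms. -/
theorem condEntropy_exchange_parent (h : ∀ A, jointEntropy p A ≠ ∞) (v a b : ι) (Pa : Finset ι) :
    condEntropy p v (insert a (Pa.erase b)) ≤ condEntropy p v Pa + condEntropy p b {a} := by
  have h1 : condEntropy p b (insert a (Pa.erase b)) ≤ condEntropy p b {a} :=
    condEntropy_anti h b (by simp)
  have h2 : condEntropy p v (insert b (insert a (Pa.erase b))) ≤ condEntropy p v Pa := by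
    refine condEntropy_anti h v fun j hj => ?_
    by_cases hjb : j = b <;> simp [hjb, hj]
  have h3 := toReal_jointEntropy_mono h
    (Finset.insert_subset_insert v (Finset.subset_insert b (insert a (Pa.erase b))))
  rw [condEntropy_eq h] at h1 h2 ⊢
  linarith

/-- $H(a\mid\Pi)\le H(a,b\mid\Pi)=H(b\mid\Pi)+H(a\mid b,\Pi)$. -/
theorem condEntropy_le_add (h : ∀ A, jointEntropy p A ≠ ∞) (a b : ι) (Pa : Finset ι) :
    condEntropy p a Pa ≤ condEntropy p b Pa + condEntropy p a {b} := by
  have h1 : condEntropy p a (insert b Pa) ≤ condEntropy p a {b} :=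
    condEntropy_anti h a (by simp)
  have h3 := toReal_jointEntropy_mono h (Finset.insert_subset_insert a (Finset.subset_insert b Pa))
  rw [condEntropy_eq h] at h1
  rw [condEntropy_eq h, condEntropy_eq h b]
  linarith

theorem condEntropy_map [DecidableEq κ] (h : ∀ A, jointEntropy p A ≠ ∞) (e : κ ↪ ι) (i : κ)
    (Pa : Finset κ) :
    condEntropy (p.map fun x j => x (e j)) i Pa = condEntropy p (e i) (Pa.map e) := by
  rw [condEntropy_eq (fun A => by rw [jointEntropy_map]; exact h _), condEntropy_eq h,
    jointEntropy_map, jointEntropy_map, Finset.map_insert]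

end CondEntropy

/-! ### Ranks, pendant nodes and contraction of two nodes. -/

namespace BDAG

variable {ι : Type*} {k : ℕ}

instance [Finite ι] : Finite (BDAG ι k) :=
  Finite.of_injective BDAG.parents fun _ _ h => BDAG.ext h

/-- A parent assignment along which a rank increases is acyclic. -/
def ofRank (parents : ι → Finset ι) (r : ι → ℕ) (hr : ∀ v, ∀ u ∈ parents v, r u < r v)
    (hcard : ∀ v, (parents v).card ≤ k) : BDAG ι k where
  parents := parents
  acyclic v hv := by
    have : ∀ u w, Relation.TransGen (fun u w => u ∈ parents w) u w → r u < r w := by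
      intro u w h
      induction h with
      | single h => exact hr _ _ h
      | tail _ h ih => exact ih.trans (hr _ _ h)
    exact lt_irrefl _ (this v v hv)
  card_parents_le := hcard

theorem exists_rank [Finite ι] (G : BDAG ι k) : ∃ r : ι → ℕ, ∀ v, ∀ u ∈ G.parents v, r u < r v := by
  -- The rank counts proper ancestors.
  refine ⟨fun v => {u | Relation.TransGen (fun u w => u ∈ G.parents w) u v}.ncard,
    fun v u huv => ?_⟩
  refine Set.ncard_lt_ncard ⟨fun w hw => Relation.TransGen.tail hw huv, fun hsub => ?_⟩
    (Set.toFinite _)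
  exact G.acyclic u (hsub (Relation.TransGen.single huv))

/-- Adds a new node with the single parent `a`. -/
theorem exists_pendant [Finite ι] (G : BDAG ι k) (hk : 1 ≤ k) (a : ι) :
    ∃ G' : BDAG (Option ι) k, G'.parents none = {some a} ∧
      ∀ i, G'.parents (some i) = (G.parents i).map Function.Embedding.some := by
  obtain ⟨r, hr⟩ := G.exists_rank
  refine ⟨ofRank (fun o => o.elim {some a} fun i => (G.parents i).map Function.Embedding.some)
    (fun o => o.elim (r a + 1) r) ?_ ?_, rfl, fun _ => rfl⟩
  · rintro (_ | v) u hu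
    · simp only [Option.elim_none, Finset.mem_singleton] at hu
      simp [hu]
    · simp only [Option.elim_some, Finset.mem_map] at hu
      obtain ⟨w, hw, rfl⟩ := hu
      exact hr v w hw
  · rintro (_ | v)
    · simpa using hk
    · simpa using G.card_parents_le v

/-- Contracts the nodes `none` and `some a`, keeping the parents of the earlier one `u`. -/
theorem exists_contraction [Finite ι] [DecidableEq ι] (G : BDAG (Option ι) k) (a : ι) :
    ∃ (G' : BDAG ι k) (u : Option ι), (u = none ∨ u = some a) ∧
      none ∉ G.parents u ∧ some a ∉ G.parents u ∧
      G'.parents a = (G.parents u).image (fun o => o.getD a) ∧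
      ∀ i, i ≠ a → G'.parents i = (G.parents (some i)).image (fun o => o.getD a) := by
  obtain ⟨r, hr⟩ := G.exists_rank
  obtain ⟨u, hu, hun, hua⟩ : ∃ u : Option ι, (u = none ∨ u = some a) ∧ r u ≤ r none ∧
      r u ≤ r (some a) := by
    rcases le_total (r none) (r (some a)) with h | h
    · exact ⟨none, Or.inl rfl, le_rfl, h⟩
    · exact ⟨some a, Or.inr rfl, h, le_rfl⟩
  -- `getD a` renames `none` to `a`. The merged node gets the smaller of the two ranks, so every
  -- outgoing edge of either node still increases the rank.
  refine ⟨ofRank (fun i => (G.parents (if i = a then u else some i)).image (fun o => o.getD a))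
    (fun i => r (if i = a then u else some i)) ?_ ?_, u, hu,
    fun h => (hr _ _ h).not_ge hun, fun h => (hr _ _ h).not_ge hua, ?_, ?_⟩
  · intro v w hw
    obtain ⟨o, ho, rfl⟩ := Finset.mem_image.1 hw
    refine lt_of_le_of_lt ?_ (hr _ _ ho)
    rcases o with _ | j
    · simpa using hun
    · by_cases hj : j = a
      · simpa [hj] using hua
      · simp [hj]
  · exact fun v => Finset.card_image_le.trans (G.card_parents_le _)
  · simp [ofRank]
  · intro i hi
    simp [ofRank, hi]

end BDAG

/-! ### Scores of classes, and the effect of contraction on the score. -/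

section Score

theorem map_some_image_getD {ι : Type*} [DecidableEq ι] (T : Finset (Option ι)) (a : ι) :
    (T.image fun o => o.getD a).map Function.Embedding.some =
      if none ∈ T then insert (some a) (T.erase none) else T := by
  ext o
  rcases o with _ | j
  · split_ifs with h <;> simp [h]
  · split_ifs with h
    · by_cases hj : j = a
      · simpa [hj] using ⟨none, h, rfl⟩
      · simp only [Finset.mem_map, Finset.mem_image, Function.Embedding.some_apply,
          Finset.mem_insert, Finset.mem_erase, Option.some.injEq, hj, false_or]
        constructor
        · rintro ⟨_, ⟨_ | i, hi, rfl⟩, rfl⟩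
          · exact absurd rfl hj
          · exact ⟨by simp, hi⟩
        · exact fun hT => ⟨j, ⟨some j, hT.2, rfl⟩, rfl⟩
    · simp only [Finset.mem_map, Finset.mem_image, Function.Embedding.some_apply,
        Option.some.injEq]
      constructor
      · rintro ⟨_, ⟨_ | i, hi, rfl⟩, rfl⟩
        · exact absurd hi h
        · exact hi
      · exact fun hT => ⟨j, ⟨some j, hT, rfl⟩, rfl⟩

variable {ι S : Type*} [Fintype ι] {k : ℕ}

theorem score_le_ecScore (p : PMF (ι → S)) (G : BDAG ι k) : score p G ≤ ecScore p (EC.mk G) :=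
  le_csSup (Set.toFinite _).bddAbove ⟨G, rfl, rfl⟩

theorem exists_score_eq_ecScore (p : PMF (ι → S)) (E : EC ι k) :
    ∃ G : BDAG ι k, EC.mk G = E ∧ score p G = ecScore p E := by
  have hne : (score p '' {G | EC.mk G = E}).Nonempty := by
    obtain ⟨G, hG⟩ := Quotient.exists_rep E
    exact ⟨_, G, hG, rfl⟩
  obtain ⟨G, hG, h⟩ := hne.csSup_mem (Set.toFinite _)
  exact ⟨G, hG, h⟩

theorem score_le_optScore (p : PMF (ι → S)) (G : BDAG ι k) : score p G ≤ optScore p k :=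
  le_ciSup (f := fun G : BDAG ι k => score p G) (Set.finite_range _).bddAbove G

variable [DecidableEq ι] {q : PMF (Option ι → S)}

/-- Each node other than `a` pays at most `lam` for reading `X_a` in place of `X_b`, and the merged
node pays at most one more `lam`. -/
theorem exists_contraction_score (h : ∀ A, jointEntropy q A ≠ ∞) (a : ι) {lam : ℝ}
    (hba : condEntropy q none {some a} ≤ lam) (hab : condEntropy q (some a) {none} ≤ lam)
    (G : BDAG (Option ι) k) :
    ∃ G' : BDAG ι k,
      score q G ≤ score (q.map fun x i => x (some i)) G' + Fintype.card ι * lam ∧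
      ∀ v ≠ a, none ∈ G.parents (some v) ∨ some a ∈ G.parents (some v) → a ∈ G'.parents v := by
  obtain ⟨G', u, hu, hn, ha, hGa, hG⟩ := G.exists_contraction a
  refine ⟨G', ?_, ?_⟩
  · have hlam : 0 ≤ lam := (condEntropy_nonneg h _ _).trans hba
    have hmap : ∀ i T, condEntropy (q.map fun x i => x (some i)) i T =
        condEntropy q (some i) (T.map Function.Embedding.some) :=
      fun i T => condEntropy_map h Function.Embedding.some i T
    have hV : ∀ i ∈ Finset.univ.erase a,
        condEntropy (q.map fun x i => x (some i)) i (G'.parents i) ≤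
          condEntropy q (some i) (G.parents (some i)) + lam := by
      intro i hi
      rw [hmap, hG i (Finset.ne_of_mem_erase hi), map_some_image_getD]
      split_ifs
      · have := condEntropy_exchange_parent h (some i) (some a) none (G.parents (some i))
        linarith
      · linarith
    have hA : condEntropy (q.map fun x i => x (some i)) a (G'.parents a) ≤
        condEntropy q none (G.parents none) + condEntropy q (some a) (G.parents (some a)) + lam := by
      have h1 := condEntropy_nonneg h none (G.parents none)
      have h2 := condEntropy_nonneg h (some a) (G.parents (some a))
      rw [hmap, hGa, map_some_image_getD, if_neg hn]
      -- The merged node inherits the parents of `u`; the other node's term is nonnegative and is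
      -- discarded.
      rcases hu with rfl | rfl
      · have := condEntropy_le_add h (some a) none (G.parents none)
        linarith
      · linarith
    have hsum := Finset.sum_le_sum hV
    rw [Finset.sum_add_distrib, Finset.sum_const, nsmul_eq_mul,
      Finset.card_erase_of_mem (Finset.mem_univ a), Finset.card_univ,
      Nat.cast_pred (Fintype.card_pos_iff.2 ⟨a⟩)] at hsum
    rw [score, score, Fintype.sum_option, ← Finset.add_sum_erase _ _ (Finset.mem_univ a),
      ← Finset.add_sum_erase _ _ (Finset.mem_univ a)]
    linarith
  · intro v hv hmem
    rw [hG v hv]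
    rcases hmem with hmem | hmem
    · exact Finset.mem_image.2 ⟨_, hmem, rfl⟩
    · exact Finset.mem_image.2 ⟨_, hmem, rfl⟩

theorem score_sub_le_optScore (h : ∀ A, jointEntropy q A ≠ ∞) (hk : 1 ≤ k) (a : ι)
    (G : BDAG ι k) :
    score (q.map fun x i => x (some i)) G - condEntropy q none {some a} ≤ optScore q k := by
  obtain ⟨G', hn, hs⟩ := G.exists_pendant hk a
  refine le_trans (le_of_eq ?_) (score_le_optScore q G')
  have hmap : ∀ i T, condEntropy (q.map fun x i => x (some i)) i T =
      condEntropy q (some i) (T.map Function.Embedding.some) :=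
    fun i T => condEntropy_map h Function.Embedding.some i T
  simp only [score, Fintype.sum_option, hn, hs, hmap]
  ring

end Score

/-! ### Deleting and adding a sink; d-separation. -/

namespace BDAG

variable {ι κ : Type*} {k : ℕ}

/-- The subgraph induced on the nodes in the range of `e`. -/
def restrict (G : BDAG ι k) (e : κ ↪ ι) : BDAG κ k where
  parents v := (G.parents (e v)).preimage e e.injective.injOn
  acyclic v hv := G.acyclic (e v) (hv.lift e fun _ _ h => Finset.mem_preimage.1 h)
  card_parents_le v := by
    rw [← Finset.card_map e]
    refine (Finset.card_le_card fun i hi => ?_).trans (G.card_parents_le (e v))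
    obtain ⟨u, hu, rfl⟩ := Finset.mem_map.1 hi
    exact Finset.mem_preimage.1 hu

variable {G : BDAG ι k} {e : κ ↪ ι} {a : ι}

@[simp]
theorem mem_restrict_parents {u v : κ} : u ∈ (G.restrict e).parents v ↔ e u ∈ G.parents (e v) := by
  simp [restrict]

theorem restrict_edge {u v : κ} : (G.restrict e).Edge u v ↔ G.Edge (e u) (e v) :=
  mem_restrict_parents

/-- A directed path cannot pass through a sink, so descendants among the kept nodes are unchanged.
-/
theorem restrict_reachable (he : ∀ i ≠ a, i ∈ Set.range e) (ha : ∀ v, a ∉ G.parents v) {v z : κ} :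
    Relation.ReflTransGen (G.restrict e).Edge v z ↔
      Relation.ReflTransGen G.Edge (e v) (e z) := by
  refine ⟨fun h => h.lift e fun _ _ => restrict_edge.1, fun h => ?_⟩
  have : ∀ i, Relation.ReflTransGen G.Edge (e v) i → ∀ w, e w = i →
      Relation.ReflTransGen (G.restrict e).Edge v w := by
    intro i hi
    induction hi with
    | refl => exact fun w hw => e.injective hw ▸ Relation.ReflTransGen.refl
    | @tail b c _ hbc ih =>
      rintro w rfl
      obtain ⟨b, rfl⟩ := he b (by rintro rfl; exact ha _ hbc)
      exact (ih b rfl).tail (restrict_edge.2 hbc)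
  exact this _ h z rfl

theorem isActivePath_map_iff (he : ∀ i ≠ a, i ∈ Set.range e) (ha : ∀ v, a ∉ G.parents v)
    {Z : Set κ} {x y : κ} {l : List κ} :
    G.IsActivePath (e '' Z) (e x) (e y) (l.map e) ↔ (G.restrict e).IsActivePath Z x y l := by
  have hhead : ∀ (o : Option κ) (z : κ), o.map e = some (e z) ↔ o = some z := by
    intro o z
    rw [← Option.map_some, (Option.map_injective e.injective).eq_iff]
  have htriple : ∀ u v w : κ,
      (((G.Edge (e u) (e v) ∧ G.Edge (e w) (e v)) →
          ∃ z ∈ e '' Z, Relation.ReflTransGen G.Edge (e v) z) ∧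
        (¬ (G.Edge (e u) (e v) ∧ G.Edge (e w) (e v)) → e v ∉ e '' Z)) ↔
      ((((G.restrict e).Edge u v ∧ (G.restrict e).Edge w v) →
          ∃ z ∈ Z, Relation.ReflTransGen (G.restrict e).Edge v z) ∧
        (¬ ((G.restrict e).Edge u v ∧ (G.restrict e).Edge w v) → v ∉ Z)) := by
    intro u v w
    simp only [restrict_edge, restrict_reachable he ha, Set.exists_mem_image,
      e.injective.mem_set_image]
  unfold IsActivePath
  rw [List.nodup_map_iff e.injective, List.head?_map, List.getLast?_map, hhead, hhead,
    List.isChain_map]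
  simp only [← restrict_edge]
  refine and_congr_right' (and_congr_right' (and_congr_right' (and_congr_right' ?_)))
  constructor
  · intro h u v w huvw
    exact (htriple u v w).1 (by simpa only [restrict_edge] using h (e u) (e v) (e w) (huvw.map e))
  · intro h u v w huvw
    obtain ⟨l', hl', heq⟩ := List.infix_map_iff.1 huvw
    obtain ⟨u, _, rfl, rfl, h₁⟩ := List.map_eq_cons_iff.1 heq.symm
    obtain ⟨v, _, rfl, rfl, h₂⟩ := List.map_eq_cons_iff.1 h₁
    obtain ⟨w, _, rfl, rfl, h₃⟩ := List.map_eq_cons_iff.1 h₂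
    obtain rfl := List.map_eq_nil_iff.1 h₃
    simpa only [restrict_edge] using (htriple u v w).2 (h u v w hl')

/-- An inner sink is a collider, and its only descendant is itself, which is not in the conditioning
set. So the sink blocks every path through it. -/
theorem IsActivePath.ne_of_mem (he : ∀ i, i ∈ Set.range e → i ≠ a) (ha : ∀ v, a ∉ G.parents v)
    {Z : Set κ} {x y : κ} {l : List ι} (h : G.IsActivePath (e '' Z) (e x) (e y) l) : a ∉ l := by
  obtain ⟨-, hx, hy, hchain, hact⟩ := h
  intro hal
  obtain ⟨s, t, rfl⟩ := List.append_of_mem hal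
  rcases List.eq_nil_or_concat s with rfl | ⟨s, u, rfl⟩
  · exact he (e x) ⟨x, rfl⟩ (by simpa using hx.symm)
  rcases t with _ | ⟨w, t⟩
  · exact he (e y) ⟨y, rfl⟩ (by simpa using hy.symm)
  have hinf : [u, a, w] <:+: s.concat u ++ a :: w :: t := ⟨s, t, by simp⟩
  have hc := hchain.infix hinf
  simp only [List.isChain_cons_cons] at hc
  have hu : G.Edge u a := hc.1.resolve_right (ha u)
  have hw : G.Edge w a := hc.2.1.resolve_left (ha w)
  obtain ⟨_, ⟨z, -, rfl⟩, hz⟩ := (hact u a w hinf).1 ⟨hu, hw⟩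
  rcases hz.cases_head with h | ⟨c, h, -⟩
  · exact he (e z) ⟨z, rfl⟩ h.symm
  · exact ha c h

theorem restrict_dSep (he : ∀ i, i ∈ Set.range e ↔ i ≠ a) (ha : ∀ v, a ∉ G.parents v)
    {X Y Z : Set κ} :
    (G.restrict e).DSep X Y Z ↔ G.DSep (e '' X) (e '' Y) (e '' Z) := by
  simp only [DSep, Set.forall_mem_image]
  refine forall₂_congr fun x _ => forall₂_congr fun y _ => not_congr ⟨?_, ?_⟩
  · rintro ⟨l, hl⟩
    exact ⟨l.map e, (isActivePath_map_iff (fun i hi => (he i).2 hi) ha).2 hl⟩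
  · rintro ⟨l, hl⟩
    have hmem : l ∈ Set.range (List.map e) := by
      rw [Set.range_list_map]
      intro i hi
      refine (he i).2 ?_
      rintro rfl
      exact hl.ne_of_mem (fun i hi => (he i).1 hi) ha hi
    obtain ⟨l, rfl⟩ := hmem
    exact ⟨l, (isActivePath_map_iff (fun i hi => (he i).2 hi) ha).1 hl⟩

/-- Markov equivalence is inherited when a common sink is removed. -/
theorem MarkovEquiv.restrict {G' : BDAG ι k} (h : G.MarkovEquiv G')
    (he : ∀ i, i ∈ Set.range e ↔ i ≠ a) (ha : ∀ v, a ∉ G.parents v)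
    (ha' : ∀ v, a ∉ G'.parents v) : (G.restrict e).MarkovEquiv (G'.restrict e) := by
  intro X Y Z hXY hXZ hYZ
  rw [restrict_dSep he ha, restrict_dSep he ha']
  exact h _ _ _ ((Set.disjoint_image_iff e.injective).2 hXY)
    ((Set.disjoint_image_iff e.injective).2 hXZ) ((Set.disjoint_image_iff e.injective).2 hYZ)

/-- Adds a sink `a` with parent set `P`. -/
theorem exists_add_sink [Fintype κ] (he : ∀ i, i ∈ Set.range e ↔ i ≠ a) (G : BDAG κ k)
    {P : Finset ι} (haP : a ∉ P) (hP : P.card ≤ k) :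
    ∃ G' : BDAG ι k, (∀ v, a ∉ G'.parents v) ∧ G'.parents a = P ∧ G'.restrict e = G := by
  obtain ⟨r, hr⟩ := G.exists_rank
  have hrange : ∀ {i}, i ≠ a → ∃ v, e v = i := fun hi => (he _).2 hi
  have hea : ¬ ∃ v, e v = a := fun h => (he a).1 h rfl
  have hpe := fun v => e.injective.extend_apply (fun v => (G.parents v).map e) (fun _ => P) v
  have hpa := Function.extend_apply' (fun v => (G.parents v).map e) (fun _ => P) a hea
  -- The sink receives rank `∑ v, r v + 1`, which exceeds all others.
  have hre := fun v => e.injective.extend_apply r (fun _ => ∑ v, r v + 1) v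
  have hra := Function.extend_apply' r (fun _ => ∑ v, r v + 1) a hea
  refine ⟨ofRank (Function.extend e (fun v => (G.parents v).map e) fun _ => P)
    (Function.extend e r fun _ => ∑ v, r v + 1) ?_ ?_, ?_, hpa, ?_⟩
  · intro v u hu
    by_cases hv : v = a
    · subst hv
      rw [hpa] at hu
      obtain ⟨u, rfl⟩ := hrange (i := u) (by rintro rfl; exact haP hu)
      rw [hre, hra]
      exact Nat.lt_succ_of_le (Finset.single_le_sum (fun _ _ => Nat.zero_le _)
        (Finset.mem_univ u))
    · obtain ⟨v, rfl⟩ := hrange hv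
      rw [hpe] at hu
      obtain ⟨u, hu', rfl⟩ := Finset.mem_map.1 hu
      rw [hre, hre]
      exact hr v u hu'
  · intro v
    by_cases hv : v = a
    · subst hv
      rwa [hpa]
    · obtain ⟨v, rfl⟩ := hrange hv
      rw [hpe, Finset.card_map]
      exact G.card_parents_le v
  · intro v
    change a ∉ Function.extend e (fun v => (G.parents v).map e) (fun _ => P) v
    by_cases hv : v = a
    · subst hv
      rwa [hpa]
    · obtain ⟨v, rfl⟩ := hrange hv
      rw [hpe, Finset.mem_map]
      rintro ⟨u, -, hu⟩
      exact hea ⟨u, hu⟩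
  · ext v u
    rw [mem_restrict_parents]
    change e u ∈ Function.extend e (fun v => (G.parents v).map e) (fun _ => P) (e v) ↔ _
    rw [hpe, Finset.mem_map' e]

end BDAG

/-! ### Transfer of the score gap to the distribution without the sink. -/

section Score

variable {ι κ S : Type*} [Fintype ι] [Fintype κ] {k : ℕ}

theorem score_eq_of_sink {p : PMF (ι → S)} (h : ∀ A, jointEntropy p A ≠ ⊤) {e : κ ↪ ι} {a : ι}
    (he : ∀ i, i ∈ Set.range e ↔ i ≠ a) {G : BDAG ι k} (ha : ∀ v, a ∉ G.parents v) :
    score p G = score (p.map fun x j => x (e j)) (G.restrict e) - condEntropy p a (G.parents a) := by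
  classical
  have huniv : (Finset.univ : Finset ι).erase a = Finset.univ.map e := by
    ext i
    simpa using (he i).symm
  have hpar : ∀ v, ((G.restrict e).parents v).map e = G.parents (e v) := by
    intro v
    ext i
    rw [Finset.mem_map]
    constructor
    · rintro ⟨u, hu, rfl⟩
      exact BDAG.mem_restrict_parents.1 hu
    · intro hi
      obtain ⟨u, rfl⟩ := (he i).2 (by rintro rfl; exact ha _ hi)
      exact ⟨u, BDAG.mem_restrict_parents.2 hi, rfl⟩
  rw [score, score, ← Finset.add_sum_erase _ _ (Finset.mem_univ a), huniv, Finset.sum_map]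
  simp_rw [condEntropy_map h, hpar]
  ring

/-- If the optimal EC has a score gap `β` and `a` is a sink in all its graphs, then the
distribution without `a` has an EC with score gap `β`. -/
theorem exists_ec_gap_of_sink {p : PMF (ι → S)} (h : ∀ A, jointEntropy p A ≠ ⊤) {e : κ ↪ ι} {a : ι}
    (he : ∀ i, i ∈ Set.range e ↔ i ≠ a) {β : ℝ} {E₁ : EC ι k}
    (hgap : ∀ E : EC ι k, E ≠ E₁ → β ≤ ecScore p E₁ - ecScore p E)
    (hsink : ∀ G : BDAG ι k, EC.mk G = E₁ → ∀ v, a ∉ G.parents v) :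
    ∃ E : EC κ k, ∀ E' ≠ E, β ≤ ecScore (p.map fun x j => x (e j)) E -
      ecScore (p.map fun x j => x (e j)) E' := by
  obtain ⟨G₁, hG₁, hs₁⟩ := exists_score_eq_ecScore p E₁
  have ha₁ := hsink G₁ hG₁
  refine ⟨EC.mk (G₁.restrict e), fun E' hE' => ?_⟩
  obtain ⟨G, rfl, hs⟩ := exists_score_eq_ecScore (p.map fun x j => x (e j)) E'
  -- Giving `a` the same parents as in `G₁` makes its entropy term cancel in the difference of
  -- scores.
  obtain ⟨G', ha', hPa, rfl⟩ := BDAG.exists_add_sink he G (ha₁ a) (G₁.card_parents_le a)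
  have hne : EC.mk G' ≠ E₁ := by
    intro heq
    exact hE' (Quotient.sound ((Quotient.exact (heq.trans hG₁.symm)).restrict he ha' ha₁))
  have h1 := hgap _ hne
  have h2 := score_le_ecScore p G'
  have h3 := score_le_ecScore (p.map fun x j => x (e j)) (G₁.restrict e)
  have h4 := score_eq_of_sink h he ha₁
  have h5 := score_eq_of_sink h he ha'
  rw [hPa] at h5
  linarith

/-- An EC with a positive score gap to every other EC is the unique optimal EC. -/
theorem isUniqueOptimalEC_of_gap {p : PMF (ι → S)} {γ : ℝ} (hγ : 0 < γ) {E : EC ι k}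
    (h : ∀ E' ≠ E, γ < ecScore p E - ecScore p E') : IsUniqueOptimalEC p E := by
  refine ⟨fun E' => ?_, fun E' hE' => ?_⟩
  · by_cases hE : E' = E
    · rw [hE]
    · linarith [h E' hE]
  · by_contra hE
    linarith [h E' hE, hE' E]

end Score

end BayesNet

end

/-! ### Stability of the noisy-copy distribution. -/

theorem theorem3 {ι S : Type*} [Fintype ι] [DecidableEq ι] (k : ℕ)
    (D₁ : PMF (ι → S)) (a : ι) (α β : ℝ) (hα : 0 < α) (hβ : 0 < β)
    -- the unique optimal EC of `D₁`, with score gap at least `β`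
    (E₁ : BayesNet.EC ι k) (hE₁ : BayesNet.IsUniqueOptimalEC D₁ E₁)
    (hgap : ∀ E : BayesNet.EC ι k, E ≠ E₁ →
      β ≤ BayesNet.ecScore D₁ E₁ - BayesNet.ecScore D₁ E)
    -- `X_a` has no children in any graph of the optimal EC
    (hchildless : ∀ G : BayesNet.BDAG ι k, BayesNet.EC.mk G = E₁ → ∀ v, a ∉ G.parents v)
    -- `H(X_a ∣ X₁ \ {X_a}) = α`
    (hent : BayesNet.condEntropy D₁ a (Finset.univ.erase a) = α)
    -- the noise level, where `d = |X₁| + 1`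
    (lam : ℝ) (hlam₀ : 0 < lam)
    (hlam : lam < min α (β / (3 * ((Fintype.card ι + 1 : ℕ) : ℝ))))
    -- the distribution `D₂(λ)` of the discrete variables `X₁ ∪ {X_b}`, where `X_b` is `none`
    (D₂ : PMF (Option ι → S)) (hfin : ∀ o, BayesNet.FiniteEntropy D₂ o)
    (hcopy : BayesNet.IsNoisyCopy D₁ a D₂)
    (hnoise : max (BayesNet.condEntropy D₂ none {some a})
      (BayesNet.condEntropy D₂ (some a) {none}) = lam)
    (γ : ℝ) (hγ₀ : 0 < γ)
    (hγ : γ ≤ β - 3 * ((Fintype.card ι + 1 : ℕ) : ℝ) * lam) :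
    BayesNet.IsStable D₂ k γ ((Finset.univ.erase a).map Function.Embedding.some) := by
  have hH := BayesNet.jointEntropy_ne_top hfin
  obtain ⟨rfl, -⟩ := hcopy
  have hba := (le_max_left _ _).trans_eq hnoise
  have hab := (le_max_right _ _).trans_eq hnoise
  have hcard : (0 : ℝ) ≤ Fintype.card ι * lam := by positivity
  push_cast at hγ
  constructor
  · intro G hG v hv o ho
    obtain ⟨v, hva, rfl⟩ := Finset.mem_map.1 hv
    have hva := Finset.ne_of_mem_erase hva
    -- The parent `o` forces `k ≥ 1`, so that `X_b` may be given the parent `X_a` in the lower bound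
    -- on `optScore`.
    have hk : 1 ≤ k := (Finset.card_pos.2 ⟨o, ho⟩).trans_le (G.card_parents_le _)
    by_contra hoV
    obtain ⟨G', hs, hG'⟩ := BayesNet.exists_contraction_score hH a hba hab G
    have hmem : a ∈ G'.parents v := by
      refine hG' v hva ?_
      rcases o with _ | i
      · exact Or.inl ho
      · have hi : i = a := by simpa using hoV
        exact Or.inr (hi ▸ ho)
    have h1 := hgap (BayesNet.EC.mk G') fun hE => hchildless G' hE v hmem
    have h2 := BayesNet.score_le_ecScore (D₂.map fun x i => x (some i)) G'
    obtain ⟨G₁, -, hs₁⟩ := BayesNet.exists_score_eq_ecScore (D₂.map fun x i => x (some i)) E₁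
    have h3 := BayesNet.score_sub_le_optScore hH hk a G₁
    -- Together the bounds give $\beta-\gamma\le d\lambda$, against $\beta-\gamma\ge
    -- 3d\lambda>d\lambda$.
    nlinarith
  · have hex : ∀ v : ((Finset.univ.erase a).map Function.Embedding.some : Finset (Option ι)),
        ∃ i, some i = v.1 ∧ i ≠ a := by
      rintro ⟨v, hv⟩
      obtain ⟨i, hi, rfl⟩ := Finset.mem_map.1 hv
      exact ⟨i, rfl, Finset.ne_of_mem_erase hi⟩
    choose f hf hfa using hex
    let e : ((Finset.univ.erase a).map Function.Embedding.some : Finset (Option ι)) ↪ ι :=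
      ⟨f, fun u v huv => Subtype.ext (by rw [← hf, ← hf, huv])⟩
    have he : ∀ i, i ∈ Set.range e ↔ i ≠ a := by
      refine fun i => ⟨?_, fun hi => ?_⟩
      · rintro ⟨v, rfl⟩
        exact hfa v
      · refine ⟨⟨some i, by simpa using hi⟩, ?_⟩
        exact Option.some_injective _ (hf _)
    have hH₁ : ∀ A, BayesNet.jointEntropy (D₂.map fun x i => x (some i)) A ≠ ⊤ := fun A =>
      (BayesNet.jointEntropy_map D₂ Function.Embedding.some A).trans_ne (hH _)
    obtain ⟨E, hE⟩ := BayesNet.exists_ec_gap_of_sink hH₁ he hgap hchildless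
    have hmarg : (D₂.map fun x i => x (some i)).map (fun x j => x (e j)) =
        BayesNet.marginal D₂ ((Finset.univ.erase a).map Function.Embedding.some) := by
      rw [PMF.map_comp, BayesNet.marginal]
      congr 1
      funext x j
      exact congrArg x (hf j)
    rw [hmarg] at hE
    -- Strictness comes from $\lambda>0$: $\gamma\le\beta-3d\lambda<\beta$.
    have hE' : ∀ E' ≠ E, γ < _ := fun E' hne => lt_of_lt_of_le (by nlinarith) (hE E' hne)
    exact ⟨E, BayesNet.isUniqueOptimalEC_of_gap hγ₀ hE', hE'⟩
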